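/- Let $k \ge 3$ and $d \ge 3$ be integers, let $\phi : SO(k) \to SO(d)$ be a continuous group homomorphism, and suppose that the subgroup $H = \phi(SO(k))$ of $SO(d)$ acts irreducibly on $\mathbb{R}^d$, that is, the only linear subspaces of $\mathbb{R}^d$ mapped into themselves by all elements of $H$ are $\{0\}$ and $\mathbb{R}^d$. Let $X = (X_1, \dots, X_d)$ be a random vector in $\mathbb{R}^d$ such that (a) the law of $X$ is invariant under $H$: for every $g \in H$ the vectors $gX$ and $X$ have the same law; (b) the family $\{X_1, \dots, X_d\}$ is exchangeable: for every permutation $\sigma$ of $\{1, \dots, d\}$ the vectors $(X_{\sigma(1)}, \dots, X_{\sigma(d)})$ and $(X_1, \dots, X_d)$ have the same law. Then the law of $X$ is $SO(d)$-invariant: for every $g \in SO(d)$ the vectors $gX$ and $X$ have the same law. If moreover $X \ne 0$ almost surely, then the random variables $|X|$ (Euclidean norm) and $X/|X|$ are independent. -/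

import Mathlib

open MeasureTheory ProbabilityTheory

noncomputable section

/-- The group `SO(n)` of real `n × n` orthogonal matrices of determinant one. -/
abbrev SO (n : ℕ) := Matrix.specialOrthogonalGroup (Fin n) ℝ

/-- The tautological representation of `SO(n)` on the Euclidean space `ℝⁿ`, in which a matrix
`g` sends the column vector `x` to `g x`. -/
def rotationRep (n : ℕ) : Representation ℝ (SO n) (EuclideanSpace ℝ (Fin n)) :=
  (Matrix.toLpLinAlgEquiv (R := ℝ) (n := Fin n) 2 : _ →* _).comp
    (Matrix.specialOrthogonalGroup (Fin n) ℝ).subtype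

theorem rotationRep_apply {n : ℕ} (g : SO n) (x : EuclideanSpace ℝ (Fin n)) :
    rotationRep n g x = WithLp.toLp 2 (g.1.mulVec x.ofLp) := rfl

/-- A subgroup `H` of `SO(n)` acts irreducibly on `ℝⁿ`: `ℝⁿ` is nonzero and has no `H`-invariant
linear subspaces other than `0` and `ℝⁿ`. -/
def ActsIrreducibly {n : ℕ} (H : Subgroup (SO n)) : Prop :=
  Representation.IsIrreducible ((rotationRep n).comp H.subtype)

/-- The law of the random vector `X` is invariant under the subgroup `H` of `SO(n)`: for every
`g ∈ H`, the random vectors `g X` and `X` have the same law. -/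
def LawInvariantUnder {n : ℕ} {Ω : Type*} [MeasurableSpace Ω] (P : Measure Ω)
    (X : Ω → EuclideanSpace ℝ (Fin n)) (H : Subgroup (SO n)) : Prop :=
  ∀ g ∈ H, IdentDistrib (fun ω => rotationRep n g (X ω)) X P P

/-- A finite family of real random variables is exchangeable: permuting it does not change its
joint law. -/
def ExchangeableFamily {ι Ω : Type*} [MeasurableSpace Ω] (P : Measure Ω)
    (Y : ι → Ω → ℝ) : Prop :=
  ∀ σ : Equiv.Perm ι, IdentDistrib (fun ω i => Y (σ i) ω) (fun ω i => Y i ω) P P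

end

/-!
The characteristic function `f` of `X` is invariant under the irreducible representation `φ` of
`SO(k)`, and exchangeability makes it invariant under the transposition of two coordinates, which is
the reflection in the hyperplane orthogonal to `e₀ - e₁`. These symmetries force `f` to be radial.

Call a unit vector a mirror if its reflection preserves `f`. The mirrors form a closed set that is
stable under `φ(SO(k))` and under the reflections in its members. If `f` took different values at
points of equal norm, there would be points `x` and `y` of the corresponding level sets on the
sphere at minimal distance, and then no mirror separates `x` from `y`: every mirror `u` satisfies
`0 ≤ ⟪x, u⟫ ⟪y, u⟫` (`exists_forall_mirrors_inner_mul_inner_nonneg`). When two mirrors `u`, `w` meet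
at an angle that is not a rational multiple of `π`, the whole unit circle of their plane consists of
mirrors, so the inequality forces `⟪x, u⟫ ⟪y, w⟫ = ⟪x, w⟫ ⟪y, u⟫`
(`inner_mul_inner_eq_of_irrational_angle`). Since `SO(k)` is connected (`SO.connectedSpace`), no
nontrivial matrix coefficient `h ↦ ⟪z, φ(h) u⟫` is constant on a nonempty open set
(`dense_setOf_inner_apply_ne`). By the Baire category theorem the `w` in the orbit of `u` can thus be
chosen to make an irrational angle with `u` while avoiding the hyperplane orthogonal to
`⟪x, u⟫ y - ⟪y, u⟫ x`, unless that vector vanishes. So it vanishes for all `u` in the orbit of a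
mirror; `y` is a nonnegative multiple of `x`, and `x = y`, which is absurd
(`eq_of_norm_eq_of_invariant`).

A radial characteristic function means that all linear isometries preserve the law. The law of the
direction of `X` on an event `‖X‖ ∈ A` is then an isometry-invariant measure on the unit sphere, and
such a measure is unique up to a scalar (`measure_smul_eq_of_isRadial`), which is the independence
of `‖X‖` and `X / ‖X‖`.
-/

open MeasureTheory ProbabilityTheory Filter Topology
open scoped RealInnerProductSpace

/-! ### Matrix coefficients of irreducible orthogonal representations -/

section Coefficients

variable {Γ E : Type*} [Group Γ] [NormedAddCommGroup E]
  [InnerProductSpace ℝ E]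

theorem Representation.IsIrreducible.submodule_eq_bot_or_eq_top {ρ : Representation ℝ Γ E}
    (hρ : ρ.IsIrreducible) (M : Submodule ℝ E) (hM : ∀ g, ∀ x ∈ M, ρ g x ∈ M) :
    M = ⊥ ∨ M = ⊤ := by
  have : IsSimpleOrder (Subrepresentation ρ) := hρ
  have := IsSimpleOrder.eq_bot_or_eq_top (α := Subrepresentation ρ) ⟨M, fun g x hx => hM g x hx⟩
  refine this.imp (fun h => ?_) (fun h => ?_)
  · exact congrArg Subrepresentation.toSubmodule h
  · exact congrArg Subrepresentation.toSubmodule h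

theorem Representation.inner_apply_left_eq {ρ : Representation ℝ Γ E}
    (hiso : ∀ g x y, ⟪ρ g x, ρ g y⟫ = ⟪x, y⟫) (g : Γ) (x y : E) :
    ⟪ρ g x, y⟫ = ⟪x, ρ g⁻¹ y⟫ := by
  rw [← hiso g x, ρ.self_inv_apply]

variable [TopologicalSpace Γ]

/-- A subgroup of a connected group that contains a neighbourhood of the identity is everything. -/
theorem Subgroup.eq_top_of_mem_nhds_one [IsTopologicalGroup Γ] [ConnectedSpace Γ]
    (K : Subgroup Γ) (hK : (K : Set Γ) ∈ 𝓝 1) : K = ⊤ := by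
  have ho : IsOpen (K : Set Γ) := K.isOpen_of_mem_nhds hK
  have hc : IsClopen (K : Set Γ) := ⟨K.isClosed_of_isOpen ho, ho⟩
  have := hc.eq_univ ⟨1, K.one_mem⟩
  exact SetLike.coe_injective (by simpa using this)

/-- The vectors `z` for which the matrix coefficient `h ↦ ⟪z, ρ h u⟫` is constant near the
identity. -/
def coeffLocallyConst (ρ : Representation ℝ Γ E) (u : E) : Submodule ℝ E where
  carrier := {z | ∀ᶠ k in 𝓝 (1 : Γ), ⟪z, ρ k u⟫ = ⟪z, u⟫}
  add_mem' {a b} ha hb := by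
    filter_upwards [ha, hb] with k h1 h2
    rw [inner_add_left, inner_add_left, h1, h2]
  zero_mem' := by simp
  smul_mem' c a ha := by
    filter_upwards [ha] with k h1
    rw [real_inner_smul_left, real_inner_smul_left, h1]

theorem mem_coeffLocallyConst {ρ : Representation ℝ Γ E} {u z : E} :
    z ∈ coeffLocallyConst ρ u ↔ ∀ᶠ k in 𝓝 (1 : Γ), ⟪z, ρ k u⟫ = ⟪z, u⟫ := Iff.rfl

variable [FiniteDimensional ℝ E]

/-- By finite dimensionality, one neighbourhood of the identity serves all vectors of
`coeffLocallyConst ρ u`. -/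
theorem eventually_forall_mem_coeffLocallyConst (ρ : Representation ℝ Γ E) (u : E) :
    ∀ᶠ k in 𝓝 (1 : Γ), ∀ z ∈ coeffLocallyConst ρ u, ⟪z, ρ k u⟫ = ⟪z, u⟫ := by
  obtain ⟨s, hs⟩ := (IsNoetherian.noetherian (coeffLocallyConst ρ u))
  have h : ∀ᶠ k in 𝓝 (1 : Γ), ∀ z ∈ s, ⟪z, ρ k u⟫ = ⟪z, u⟫ := by
    rw [Finset.eventually_all]
    intro z hz
    exact mem_coeffLocallyConst.1 (hs ▸ Submodule.subset_span hz)
  filter_upwards [h] with k hk z hz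
  rw [← hs] at hz
  induction hz using Submodule.span_induction with
  | mem x hx => exact hk x hx
  | zero => simp
  | add x y _ _ hx hy => rw [inner_add_left, inner_add_left, hx, hy]
  | smul c x _ hx => rw [real_inner_smul_left, real_inner_smul_left, hx]

variable [IsTopologicalGroup Γ] [ConnectedSpace Γ]

theorem apply_mem_coeffLocallyConst {ρ : Representation ℝ Γ E}
    (hiso : ∀ g x y, ⟪ρ g x, ρ g y⟫ = ⟪x, y⟫) (u : E) (g : Γ) {z : E}
    (hz : z ∈ coeffLocallyConst ρ u) : ρ g z ∈ coeffLocallyConst ρ u := by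
  let K : Subgroup Γ :=
    { carrier := {g | (∀ z ∈ coeffLocallyConst ρ u, ρ g z ∈ coeffLocallyConst ρ u) ∧
        ∀ z ∈ coeffLocallyConst ρ u, ρ g⁻¹ z ∈ coeffLocallyConst ρ u}
      mul_mem' := by
        rintro a b ⟨ha, ha'⟩ ⟨hb, hb'⟩
        refine ⟨fun z hz => ?_, fun z hz => ?_⟩
        · rw [map_mul]; exact ha _ (hb _ hz)
        · rw [mul_inv_rev, map_mul]; exact hb' _ (ha' _ hz)
      one_mem' := by simp
      inv_mem' := by
        rintro a ⟨ha, ha'⟩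
        exact ⟨ha', by simpa using ha⟩ }
  suffices h : K = ⊤ by
    have hg : g ∈ K := h ▸ Subgroup.mem_top g
    exact hg.1 z hz
  refine K.eq_top_of_mem_nhds_one ?_
  have key : ∀ᶠ g in 𝓝 (1 : Γ), ∀ z ∈ coeffLocallyConst ρ u,
      ρ g⁻¹ z ∈ coeffLocallyConst ρ u := by
    have h1 := eventually_forall_mem_coeffLocallyConst ρ u
    filter_upwards [h1, eventually_eventually_nhds.2 h1] with g hg hg' z hz
    have ht : Tendsto (fun k => g * k) (𝓝 1) (𝓝 g) := by
      simpa using (continuous_const_mul g).tendsto 1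
    filter_upwards [ht.eventually hg'] with k hk
    rw [ρ.inner_apply_left_eq hiso, ρ.inner_apply_left_eq hiso, inv_inv, hg z hz,
      ← Module.End.mul_apply, ← map_mul, hk z hz]
  have key' : ∀ᶠ g in 𝓝 (1 : Γ), ∀ z ∈ coeffLocallyConst ρ u,
      ρ g z ∈ coeffLocallyConst ρ u := by
    have ht : Tendsto (fun k : Γ => k⁻¹) (𝓝 1) (𝓝 1) := by
      simpa using (continuous_inv (G := Γ)).tendsto 1
    simpa using ht.eventually key
  filter_upwards [key, key'] with g h1 h2 using ⟨h2, h1⟩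

theorem coeffLocallyConst_eq_bot {ρ : Representation ℝ Γ E}
    (hiso : ∀ g x y, ⟪ρ g x, ρ g y⟫ = ⟪x, y⟫) (hirr : ρ.IsIrreducible)
    (hdim : 1 < Module.finrank ℝ E) {u : E} (hu : u ≠ 0) : coeffLocallyConst ρ u = ⊥ := by
  refine (hirr.submodule_eq_bot_or_eq_top _
    fun g z hz => apply_mem_coeffLocallyConst hiso u g hz).resolve_right fun htop => ?_
  -- Otherwise `u` is fixed near the identity, hence by the whole group, and spans an invariant
  -- line.
  let K : Subgroup Γ :=
    { carrier := {g | ρ g u = u}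
      mul_mem' := by
        intro a b ha hb
        simp only [Set.mem_ofPred_eq] at ha hb ⊢
        rw [map_mul, Module.End.mul_apply, hb, ha]
      one_mem' := by simp
      inv_mem' := by
        intro a ha
        simp only [Set.mem_ofPred_eq] at ha ⊢
        conv_lhs => rw [← ha]
        exact ρ.inv_self_apply a u }
  have hK : K = ⊤ := by
    refine K.eq_top_of_mem_nhds_one ?_
    filter_upwards [eventually_forall_mem_coeffLocallyConst ρ u] with k hk
    exact ext_inner_left ℝ fun z => hk z (htop ▸ Submodule.mem_top)
  have hfix : ∀ g, ρ g u = u := fun g => by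
    have hg : g ∈ K := hK ▸ Subgroup.mem_top g
    exact hg
  rcases hirr.submodule_eq_bot_or_eq_top (Submodule.span ℝ {u}) (fun g x hx => by
    obtain ⟨c, rfl⟩ := Submodule.mem_span_singleton.1 hx
    rwa [map_smul, hfix]) with h | h
  · exact hu (Submodule.span_singleton_eq_bot.1 h)
  · have := finrank_span_singleton (K := ℝ) hu
    rw [h, finrank_top] at this
    omega

/-- A nontrivial matrix coefficient of an irreducible orthogonal representation of a connected
group is not constant on any nonempty open set. -/
theorem dense_setOf_inner_apply_ne {ρ : Representation ℝ Γ E}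
    (hiso : ∀ g x y, ⟪ρ g x, ρ g y⟫ = ⟪x, y⟫) (hirr : ρ.IsIrreducible)
    (hdim : 1 < Module.finrank ℝ E) {u z : E} (hu : u ≠ 0) (hz : z ≠ 0) (c : ℝ) :
    Dense {h | ⟪z, ρ h u⟫ ≠ c} := by
  have : {h | ⟪z, ρ h u⟫ ≠ c} = {h | ⟪z, ρ h u⟫ = c}ᶜ := rfl
  rw [this, ← interior_eq_empty_iff_dense_compl, Set.eq_empty_iff_forall_notMem]
  intro g hg
  have hev : ∀ᶠ h in 𝓝 g, ⟪z, ρ h u⟫ = c := mem_interior_iff_mem_nhds.1 hg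
  have ht : Tendsto (fun k => g * k) (𝓝 1) (𝓝 g) := by
    simpa using (continuous_const_mul g).tendsto 1
  have hmem : ρ g⁻¹ z ∈ coeffLocallyConst ρ u := by
    filter_upwards [ht.eventually hev] with k hk
    rw [ρ.inner_apply_left_eq hiso, ρ.inner_apply_left_eq hiso, inv_inv, hev.self_of_nhds,
      ← Module.End.mul_apply, ← map_mul, hk]
  rw [coeffLocallyConst_eq_bot hiso hirr hdim hu, Submodule.mem_bot] at hmem
  apply hz
  rw [← ρ.self_inv_apply g z, hmem, map_zero]

end Coefficients

/-! ### Topology of `SO(n)` -/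

section SpecialOrthogonal

variable {n : ℕ}

theorem SO.transpose_mul_self (g : SO n) : g.1.transpose * g.1 = 1 :=
  (Matrix.mem_orthogonalGroup_iff' _ _).1 (Matrix.mem_specialOrthogonalGroup_iff.1 g.2).1

theorem SO.det_eq_one (g : SO n) : g.1.det = 1 :=
  (Matrix.mem_specialOrthogonalGroup_iff.1 g.2).2

instance SO.isTopologicalGroup : IsTopologicalGroup (SO n) where
  continuous_inv := by
    refine continuous_induced_rng.2 ?_
    exact (Continuous.matrix_transpose continuous_subtype_val :
      Continuous fun g : SO n => g.1.transpose)

theorem SO.isClosed :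
    IsClosed (Matrix.specialOrthogonalGroup (Fin n) ℝ : Set (Matrix (Fin n) (Fin n) ℝ)) := by
  have : (Matrix.specialOrthogonalGroup (Fin n) ℝ : Set (Matrix (Fin n) (Fin n) ℝ)) =
      {A | A.transpose * A = 1} ∩ {A | A.det = 1} := by
    ext A
    exact Matrix.mem_specialOrthogonalGroup_iff.trans
      (and_congr (Matrix.mem_orthogonalGroup_iff' _ _) Iff.rfl)
  rw [this]
  exact (isClosed_eq (by fun_prop) continuous_const).inter
    (isClosed_eq (by fun_prop) continuous_const)

instance SO.locallyCompactSpace : LocallyCompactSpace (SO n) :=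
  haveI : LocallyCompactSpace (Matrix (Fin n) (Fin n) ℝ) :=
    inferInstanceAs (LocallyCompactSpace (Fin n → Fin n → ℝ))
  SO.isClosed.isClosedEmbedding_subtypeVal.locallyCompactSpace

theorem inner_rotationRep (g : SO n) (x y : EuclideanSpace ℝ (Fin n)) :
    ⟪rotationRep n g x, rotationRep n g y⟫ = ⟪x, y⟫ := by
  simp only [rotationRep_apply, EuclideanSpace.inner_eq_star_dotProduct, star_trivial]
  rw [Matrix.dotProduct_mulVec, Matrix.vecMul_mulVec, ← Matrix.dotProduct_mulVec,
    SO.transpose_mul_self, Matrix.one_mulVec]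

theorem continuous_rotationRep_apply (x : EuclideanSpace ℝ (Fin n)) :
    Continuous fun g => rotationRep n g x := by
  simp only [rotationRep_apply]
  exact (PiLp.continuous_toLp 2 _).comp
    (Continuous.matrix_mulVec continuous_subtype_val continuous_const)

/-- The matrix `1 - 2 u uᵀ`, which for a unit vector `u` is that of the reflection in the
hyperplane orthogonal to `u`. -/
def householderMatrix (u : EuclideanSpace ℝ (Fin n)) : Matrix (Fin n) (Fin n) ℝ :=
  1 - (2 : ℝ) • Matrix.vecMulVec u.ofLp u.ofLp

theorem continuous_householderMatrix :
    Continuous (householderMatrix : EuclideanSpace ℝ (Fin n) → _) := by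
  unfold householderMatrix
  have h := PiLp.continuous_ofLp 2 (fun _ : Fin n => ℝ)
  have h' := Continuous.matrix_vecMulVec h h
  fun_prop

theorem householderMatrix_mulVec (u x : EuclideanSpace ℝ (Fin n)) :
    WithLp.toLp 2 ((householderMatrix u).mulVec x.ofLp) = x - (2 * ⟪u, x⟫) • u := by
  ext i
  simp only [householderMatrix, Matrix.sub_mulVec, Matrix.one_mulVec, Matrix.smul_mulVec,
    Matrix.vecMulVec_mulVec, EuclideanSpace.inner_eq_star_dotProduct, star_trivial]
  simp [dotProduct_comm]
  ring

theorem dotProduct_self_of_norm_eq_one {u : EuclideanSpace ℝ (Fin n)} (hu : ‖u‖ = 1) :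
    u.ofLp ⬝ᵥ u.ofLp = 1 := by
  have := real_inner_self_eq_norm_sq u
  rw [EuclideanSpace.inner_eq_star_dotProduct] at this
  simpa [hu] using this

theorem householderMatrix_mul_self {u : EuclideanSpace ℝ (Fin n)} (hu : ‖u‖ = 1) :
    householderMatrix u * householderMatrix u = 1 := by
  simp only [householderMatrix, sub_mul, mul_sub, one_mul, mul_one, Matrix.smul_mul,
    Matrix.mul_smul, Matrix.vecMulVec_mul_vecMulVec, dotProduct_self_of_norm_eq_one hu, one_smul]
  module

theorem det_householderMatrix {u : EuclideanSpace ℝ (Fin n)} (hu : ‖u‖ = 1) :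
    (householderMatrix u).det = -1 := by
  have h : householderMatrix u = 1 + Matrix.replicateCol Unit ((-2 : ℝ) • u.ofLp) *
      Matrix.replicateRow Unit u.ofLp := by
    rw [← Matrix.vecMulVec_eq, Matrix.smul_vecMulVec, householderMatrix]
    module
  rw [h, Matrix.det_one_add_replicateCol_mul_replicateRow, dotProduct_smul,
    dotProduct_self_of_norm_eq_one hu]
  norm_num

theorem householderMatrix_mul_mem {u v : EuclideanSpace ℝ (Fin n)} (hu : ‖u‖ = 1) (hv : ‖v‖ = 1) :
    householderMatrix u * householderMatrix v ∈ Matrix.specialOrthogonalGroup (Fin n) ℝ := by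
  have hmem : ∀ w : EuclideanSpace ℝ (Fin n), ‖w‖ = 1 →
      householderMatrix w ∈ Matrix.orthogonalGroup (Fin n) ℝ := by
    intro w hw
    rw [Matrix.mem_orthogonalGroup_iff']
    have : (householderMatrix w).transpose = householderMatrix w := by
      simp [householderMatrix, Matrix.transpose_vecMulVec]
    rw [this, householderMatrix_mul_self hw]
  refine Matrix.mem_specialOrthogonalGroup_iff.2 ⟨mul_mem (hmem u hu) (hmem v hv), ?_⟩
  rw [Matrix.det_mul, det_householderMatrix hu, det_householderMatrix hv]
  norm_num

theorem reflection_apply_of_norm_eq_one {E : Type*} [NormedAddCommGroup E] [InnerProductSpace ℝ E]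
    {u : E} (hu : ‖u‖ = 1) (x : E) :
    (ℝ ∙ u)ᗮ.reflection x = x - (2 * ⟪u, x⟫) • u := by
  rw [Submodule.reflection_orthogonal_apply, Submodule.reflection_singleton_apply, hu]
  simp
  module

theorem householderMatrix_mul_mem_connectedComponent (hn : 2 ≤ n)
    {u v : EuclideanSpace ℝ (Fin n)} (hu : ‖u‖ = 1) (hv : ‖v‖ = 1) :
    (⟨_, householderMatrix_mul_mem hu hv⟩ : SO n) ∈ Subgroup.connectedComponentOfOne (SO n) := by
  have hrank : 1 < Module.rank ℝ (EuclideanSpace ℝ (Fin n)) := by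
    rw [← Module.finrank_eq_rank, finrank_euclideanSpace_fin]
    exact_mod_cast hn
  have hS : PreconnectedSpace (Metric.sphere (0 : EuclideanSpace ℝ (Fin n)) 1) :=
    isPreconnected_iff_preconnectedSpace.1 (isPreconnected_sphere hrank 0 1)
  -- The second mirror moves continuously from `u`, where the product is `1`, to `v`.
  let F : Metric.sphere (0 : EuclideanSpace ℝ (Fin n)) 1 → SO n := fun w =>
    ⟨_, householderMatrix_mul_mem hu (mem_sphere_zero_iff_norm.1 w.2)⟩
  have hF : Continuous F :=
    (continuous_const.mul (continuous_householderMatrix.comp continuous_subtype_val)).subtype_mk _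
  have h1 : (1 : SO n) ∈ Set.range F :=
    ⟨⟨u, by simpa using hu⟩, Subtype.ext (householderMatrix_mul_self hu)⟩
  exact (isPreconnected_range hF).subset_connectedComponent h1
    ⟨⟨v, by simpa using hv⟩, rfl⟩

/-- A product of reflections lies, as a matrix, in the identity component of `SO(n)` or in its
coset by a fixed reflection. -/
theorem exists_mem_connectedComponent_of_reflections (hn : 2 ≤ n)
    {e : EuclideanSpace ℝ (Fin n)} (he : ‖e‖ = 1) (l : List (EuclideanSpace ℝ (Fin n))) :
    ∃ c ∈ Subgroup.connectedComponentOfOne (SO n),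
      (∀ x, (l.map fun v => (ℝ ∙ v)ᗮ.reflection).prod x = WithLp.toLp 2 (c.1.mulVec x.ofLp)) ∨
      (∀ x, (l.map fun v => (ℝ ∙ v)ᗮ.reflection).prod x =
        WithLp.toLp 2 ((householderMatrix e * c.1).mulVec x.ofLp)) := by
  induction l with
  | nil => exact ⟨1, one_mem _, Or.inl fun x => by simp⟩
  | cons v l ih =>
    obtain ⟨c, hc, ih⟩ := ih
    by_cases hv : v = 0
    · subst hv
      refine ⟨c, hc, ?_⟩
      simpa [Submodule.reflection_mem_subspace_eq_self] using ih
    have hu : ‖‖v‖⁻¹ • v‖ = 1 := norm_smul_inv_norm hv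
    have hspan : (ℝ ∙ v) = ℝ ∙ (‖v‖⁻¹ • v) :=
      (Submodule.span_singleton_smul_eq
        (IsUnit.mk0 _ (inv_ne_zero (norm_ne_zero_iff.2 hv))) v).symm
    have hstep : ∀ x, (List.map (fun v => (ℝ ∙ v)ᗮ.reflection) (v :: l)).prod x =
        WithLp.toLp 2 ((householderMatrix (‖v‖⁻¹ • v)).mulVec
          ((l.map fun v => (ℝ ∙ v)ᗮ.reflection).prod x).ofLp) := by
      intro x
      rw [householderMatrix_mulVec, ← reflection_apply_of_norm_eq_one hu]
      simp only [List.map_cons, List.prod_cons, LinearIsometryEquiv.coe_mul, Function.comp_apply]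
      simp only [hspan]
    rcases ih with ih | ih
    · refine ⟨⟨_, householderMatrix_mul_mem he hu⟩ * c,
        mul_mem (householderMatrix_mul_mem_connectedComponent hn he hu) hc, Or.inr fun x => ?_⟩
      rw [hstep, ih]
      simp only [Submonoid.coe_mul, ← mul_assoc, householderMatrix_mul_self he, one_mul,
        Matrix.mulVec_mulVec]
    · refine ⟨⟨_, householderMatrix_mul_mem hu he⟩ * c,
        mul_mem (householderMatrix_mul_mem_connectedComponent hn hu he) hc, Or.inl fun x => ?_⟩
      rw [hstep, ih]
      simp only [Submonoid.coe_mul, ← mul_assoc, Matrix.mulVec_mulVec]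

/-- By the Cartan–Dieudonné theorem every rotation is a product of reflections; the determinant
shows that their number is even, and a product of two reflections can be deformed to `1`. -/
theorem SO.connectedSpace (hn : 2 ≤ n) : ConnectedSpace (SO n) := by
  suffices h : Subgroup.connectedComponentOfOne (SO n) = ⊤ by
    refine connectedSpace_iff_univ.2 ?_
    have h' : connectedComponent (1 : SO n) = Set.univ := congrArg SetLike.coe h
    exact h' ▸ isConnected_connectedComponent
  refine eq_top_iff.2 fun g _ => ?_
  have hnorm : ∀ x, ‖rotationRep n g x‖ = ‖x‖ := fun x => by
    rw [@norm_eq_sqrt_real_inner _ _ _ (rotationRep n g x), inner_rotationRep,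
      ← norm_eq_sqrt_real_inner]
  obtain ⟨l, -, hl⟩ := (LinearIsometry.toLinearIsometryEquiv
    (⟨rotationRep n g, hnorm⟩ : EuclideanSpace ℝ (Fin n) →ₗᵢ[ℝ] EuclideanSpace ℝ (Fin n))
    rfl).reflections_generate_dim
  have hl' : ∀ x, WithLp.toLp 2 (g.1.mulVec x.ofLp) =
      (l.map fun v => (ℝ ∙ v)ᗮ.reflection).prod x := fun x => by rw [← hl]; rfl
  have heq : ∀ A B : Matrix (Fin n) (Fin n) ℝ, (∀ x : EuclideanSpace ℝ (Fin n),
      WithLp.toLp 2 (A.mulVec x.ofLp) = WithLp.toLp 2 (B.mulVec x.ofLp)) → A = B :=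
    fun A B h => Matrix.toLin'.injective (LinearMap.ext fun x =>
      (WithLp.toLp_injective 2) (h (WithLp.toLp 2 x)))
  have he : ‖EuclideanSpace.single (⟨0, by omega⟩ : Fin n) (1 : ℝ)‖ = 1 := by simp
  obtain ⟨c, hc, h | h⟩ := exists_mem_connectedComponent_of_reflections hn he l
  · have : g = c := Subtype.ext (heq _ _ fun x => (hl' x).trans (h x))
    exact this ▸ hc
  · have hdet := congrArg Matrix.det (heq _ _ fun x => (hl' x).trans (h x))
    rw [Matrix.det_mul, det_householderMatrix he, SO.det_eq_one, SO.det_eq_one] at hdet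
    norm_num at hdet

end SpecialOrthogonal

/-! ### Hyperplane reflections preserving a function -/

section Reflections

variable {E : Type*} [NormedAddCommGroup E] [InnerProductSpace ℝ E]

/-- The map `x ↦ x - 2 ⟪u, x⟫ u`, which for a unit vector `u` is the reflection in the hyperplane
orthogonal to `u`. This form is jointly continuous in `u` and `x`. -/
def householder (u x : E) : E := x - (2 * ⟪u, x⟫) • u

theorem continuous_householder_left (x : E) : Continuous fun u => householder u x := by
  unfold householder
  fun_prop

theorem inner_householder_householder {u : E} (hu : ‖u‖ = 1) (x y : E) :
    ⟪householder u x, householder u y⟫ = ⟪x, y⟫ := by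
  simp only [householder, inner_sub_left, inner_sub_right, real_inner_smul_left,
    real_inner_smul_right, real_inner_self_eq_norm_sq, hu, real_inner_comm u x]
  ring

theorem norm_householder {u : E} (hu : ‖u‖ = 1) (x : E) : ‖householder u x‖ = ‖x‖ := by
  rw [@norm_eq_sqrt_real_inner _ _ _ (householder u x), inner_householder_householder hu,
    ← norm_eq_sqrt_real_inner]

theorem householder_householder {u : E} (hu : ‖u‖ = 1) (x : E) :
    householder u (householder u x) = x := by
  simp only [householder, inner_sub_right, real_inner_smul_right, real_inner_self_eq_norm_sq, hu]
  module

/-- Reflecting the mirror: the reflection in `householder u w` is the conjugate by the reflection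
in `u` of the reflection in `w`. -/
theorem householder_householder_left {u : E} (hu : ‖u‖ = 1) (w x : E) :
    householder (householder u w) x = householder u (householder w (householder u x)) := by
  have h : ⟪householder u w, x⟫ = ⟪w, householder u x⟫ := by
    rw [← inner_householder_householder hu (householder u w), householder_householder hu]
  have hlin : ∀ (c : ℝ) (y z : E),
      householder u (y - c • z) = householder u y - c • householder u z := by
    intro c y z
    simp only [householder, inner_sub_right, real_inner_smul_right]
    module
  rw [householder, h, householder.eq_1 w, hlin, householder_householder hu]

theorem householder_neg_left (u x : E) : householder (-u) x = householder u x := by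
  simp [householder]

/-- The vectors `u` for which `householder u` leaves the function `f` invariant. They are not
required to be unit vectors, so that the set is visibly closed. -/
def mirrors (f : E → ℂ) : Set E := {u | ∀ x, f (householder u x) = f x}

theorem isClosed_mirrors {f : E → ℂ} (hf : Continuous f) : IsClosed (mirrors f) := by
  have : mirrors f = ⋂ x, {u | f (householder u x) = f x} := by
    ext u
    simp [mirrors]
  rw [this]
  exact isClosed_iInter fun x =>
    isClosed_eq (hf.comp (continuous_householder_left x)) continuous_const

theorem neg_mem_mirrors {f : E → ℂ} {u : E} (hu : u ∈ mirrors f) : -u ∈ mirrors f := fun x => by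
  rw [householder_neg_left, hu x]

theorem householder_mem_mirrors {f : E → ℂ} {u w : E} (hu1 : ‖u‖ = 1) (hu : u ∈ mirrors f)
    (hw : w ∈ mirrors f) : householder u w ∈ mirrors f := fun x => by
  rw [householder_householder_left hu1, hu, hw, hu]

theorem apply_mem_mirrors {Γ : Type*} [Group Γ] {ρ : Representation ℝ Γ E}
    (hiso : ∀ g x y, ⟪ρ g x, ρ g y⟫ = ⟪x, y⟫) {f : E → ℂ} (hf : ∀ g x, f (ρ g x) = f x)
    {u : E} (hu : u ∈ mirrors f) (g : Γ) : ρ g u ∈ mirrors f := fun x => by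
  have : householder (ρ g u) x = ρ g (householder u (ρ g⁻¹ x)) := by
    rw [householder, householder, map_sub, map_smul, ρ.self_inv_apply,
      ρ.inner_apply_left_eq hiso]
  rw [this, hf, hu, hf]

/-- A closed set of angles that contains `0` and `θ` and is stable under point reflections and
the half turn contains all angles, if `θ / π` is irrational. -/
theorem eq_univ_of_irrational_angle {T : Set ℝ} (hT : IsClosed T) {θ : ℝ}
    (hθ : Irrational (θ / Real.pi)) (h0 : (0 : ℝ) ∈ T) (h1 : θ ∈ T)
    (hrefl : ∀ a ∈ T, ∀ b ∈ T, 2 * a - b ∈ T) (hpi : ∀ a ∈ T, a + Real.pi ∈ T) :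
    T = Set.univ := by
  have hneg : ∀ a ∈ T, -a ∈ T := fun a ha => by simpa using hrefl 0 h0 a ha
  have hpi' : ∀ a ∈ T, a - Real.pi ∈ T := fun a ha => by
    have := hneg _ (hpi _ (hneg a ha))
    rwa [neg_add, neg_neg, ← sub_eq_add_neg] at this
  have hpair : ∀ m : ℕ, m * θ ∈ T ∧ (m + 1 : ℝ) * θ ∈ T := by
    intro m
    induction m with
    | zero => simpa using ⟨h0, h1⟩
    | succ m ih =>
      refine ⟨by exact_mod_cast ih.2, ?_⟩
      have := hrefl _ ih.2 _ ih.1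
      convert this using 1
      push_cast
      ring
  have hθint : ∀ m : ℤ, m * θ ∈ T := by
    intro m
    obtain ⟨k, rfl | rfl⟩ := m.eq_nat_or_neg
    · exact_mod_cast (hpair k).1
    · have := hneg _ (hpair k).1
      rw [← neg_mul] at this
      exact_mod_cast this
  have hall : ∀ n : ℤ, ∀ a ∈ T, a + n * Real.pi ∈ T := by
    intro n a ha
    induction n using Int.induction_on with
    | zero => simpa using ha
    | succ i ih =>
      have := hpi _ ih
      convert this using 1
      push_cast
      ring
    | pred i ih =>
      have := hpi' _ ih
      convert this using 1
      push_cast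
      ring
  have hd : Dense T := by
    refine (dense_addSubgroupClosure_pair_iff.2 hθ).mono ?_
    intro t ht
    obtain ⟨m, n, rfl⟩ := AddSubgroup.mem_closure_pair.1 ht
    have := hall n _ (hθint m)
    simpa using this
  rw [← hT.closure_eq, hd.closure_eq]

theorem norm_cos_smul_add_sin_smul_sq {u e : E} (hu : ‖u‖ = 1) (hue : ⟪u, e⟫ = 0) (t : ℝ) :
    ‖Real.cos t • u + Real.sin t • e‖ ^ 2 = Real.cos t ^ 2 + Real.sin t ^ 2 * ‖e‖ ^ 2 := by
  rw [norm_add_sq_real, real_inner_smul_left, real_inner_smul_right, hue, norm_smul, norm_smul,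
    mul_pow, mul_pow, hu, Real.norm_eq_abs, Real.norm_eq_abs, sq_abs, sq_abs]
  ring

/-- If two unit mirrors `u` and `cos θ • u + sin θ • e` meet at an irrational angle, every unit
vector of their plane is a mirror. -/
theorem mem_mirrors_of_irrational_angle {f : E → ℂ} (hf : Continuous f) {u e : E} (hu : ‖u‖ = 1)
    (he : ‖e‖ = 1) (hue : ⟪u, e⟫ = 0) {θ : ℝ} (hθ : Irrational (θ / Real.pi))
    (hu' : u ∈ mirrors f) (hθ' : Real.cos θ • u + Real.sin θ • e ∈ mirrors f) (t : ℝ) :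
    Real.cos t • u + Real.sin t • e ∈ mirrors f := by
  have heu : ⟪e, u⟫ = 0 := by rw [real_inner_comm, hue]
  let p : ℝ → E := fun t => Real.cos t • u + Real.sin t • e
  have hinner : ∀ a b, ⟪p a, p b⟫ = Real.cos (a - b) := fun a b => by
    simp only [p, inner_add_left, inner_add_right, real_inner_smul_left, real_inner_smul_right,
      real_inner_self_eq_norm_sq, hu, he, hue, heu, Real.cos_sub]
    ring
  have hnorm : ∀ a, ‖p a‖ = 1 := fun a => by
    have := real_inner_self_eq_norm_sq (p a)
    rw [hinner, sub_self, Real.cos_zero] at this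
    nlinarith [norm_nonneg (p a)]
  have hp : Continuous p := by fun_prop
  have hT : {t | p t ∈ mirrors f} = Set.univ := by
    refine eq_univ_of_irrational_angle ((isClosed_mirrors hf).preimage hp) hθ ?_ hθ' ?_ ?_
    · simpa [p] using hu'
    · intro a ha b hb
      have h := neg_mem_mirrors (householder_mem_mirrors (hnorm a) ha hb)
      have heq : p (2 * a - b) = -householder (p a) (p b) := by
        rw [householder, hinner]
        have e1 : Real.cos (2 * a - b) = 2 * Real.cos (a - b) * Real.cos a - Real.cos b := by
          have h1 : 2 * a - b = (a - b) + a := by ring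
          have h2 : b = a - (a - b) := by ring
          have h3 : Real.cos b = Real.cos (a - (a - b)) := by rw [← h2]
          rw [h3, h1, Real.cos_add, Real.cos_sub a (a - b)]
          ring
        have e2 : Real.sin (2 * a - b) = 2 * Real.cos (a - b) * Real.sin a - Real.sin b := by
          have h1 : 2 * a - b = (a - b) + a := by ring
          have h2 : b = a - (a - b) := by ring
          have h3 : Real.sin b = Real.sin (a - (a - b)) := by rw [← h2]
          rw [h3, h1, Real.sin_add, Real.sin_sub a (a - b)]
          ring
        simp only [p, e1, e2]
        module
      rw [Set.mem_ofPred_eq, heq]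
      exact h
    · intro a ha
      have h := neg_mem_mirrors ha
      have heq : p (a + Real.pi) = -p a := by
        simp only [p, Real.cos_add_pi, Real.sin_add_pi]
        module
      rw [Set.mem_ofPred_eq, heq]
      exact h
  exact Set.eq_univ_iff_forall.1 hT t

/-- Two linear forms on the plane whose product is nonnegative on the unit circle are
proportional. -/
theorem mul_eq_mul_of_forall_angle {a b c d : ℝ}
    (h : ∀ t, 0 ≤ (a * Real.cos t + b * Real.sin t) * (c * Real.cos t + d * Real.sin t)) :
    a * d = b * c := by
  by_contra hne
  have hD : a * d - b * c ≠ 0 := sub_ne_zero.2 hne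
  -- At this point of the plane the two forms take the values `1` and `-1`.
  let z : ℂ := ⟨(d + b) / (a * d - b * c), -(a + c) / (a * d - b * c)⟩
  have hre := Complex.norm_mul_cos_arg z
  have him := Complex.norm_mul_sin_arg z
  have h1 : a * z.re + b * z.im = 1 := by
    simp only [z]
    field_simp
    ring
  have h2 : c * z.re + d * z.im = -1 := by
    calc _ = -((a * d - b * c) / (a * d - b * c)) := by simp only [z]; ring
      _ = -1 := by rw [div_self hD]
  have h3 : ‖z‖ ^ 2 * ((a * Real.cos z.arg + b * Real.sin z.arg) *
      (c * Real.cos z.arg + d * Real.sin z.arg)) = -1 := by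
    calc _ = (a * (‖z‖ * Real.cos z.arg) + b * (‖z‖ * Real.sin z.arg)) *
          (c * (‖z‖ * Real.cos z.arg) + d * (‖z‖ * Real.sin z.arg)) := by ring
      _ = -1 := by rw [hre, him, h1, h2]; norm_num
  have := mul_nonneg (sq_nonneg ‖z‖) (h z.arg)
  linarith

/-- If no mirror of `f` separates `x` from `y`, then `x` and `y` have proportional coordinates with
respect to any two mirrors that meet at an irrational angle. -/
theorem inner_mul_inner_eq_of_irrational_angle {f : E → ℂ} (hf : Continuous f) {x y : E}
    (hxy : ∀ u ∈ mirrors f, ‖u‖ = 1 → 0 ≤ ⟪x, u⟫ * ⟪y, u⟫) {u w : E} (hu : ‖u‖ = 1) (hw : ‖w‖ = 1)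
    (hu' : u ∈ mirrors f) (hw' : w ∈ mirrors f)
    (hangle : ∀ q : ℚ, ⟪u, w⟫ ≠ Real.cos (q * Real.pi)) :
    ⟪x, u⟫ * ⟪y, w⟫ = ⟪x, w⟫ * ⟪y, u⟫ := by
  have habs : |⟪u, w⟫| ≤ 1 := by simpa [hu, hw] using abs_real_inner_le_norm u w
  obtain ⟨θ, hθcos⟩ : ∃ θ, Real.cos θ = ⟪u, w⟫ :=
    ⟨_, Real.cos_arccos (abs_le.1 habs).1 (abs_le.1 habs).2⟩
  have hirr : Irrational (θ / Real.pi) := by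
    rintro ⟨q, hq⟩
    refine hangle q ?_
    rw [hq, div_mul_cancel₀ _ Real.pi_ne_zero, hθcos]
  have hsin : Real.sin θ ≠ 0 := by
    intro h
    obtain ⟨n, hn⟩ := Real.sin_eq_zero_iff.1 h
    refine hangle n ?_
    rw [← hθcos, ← hn]
    simp
  obtain ⟨e, he_def⟩ : ∃ e, e = (Real.sin θ)⁻¹ • (w - Real.cos θ • u) := ⟨_, rfl⟩
  have hw_eq : w = Real.cos θ • u + Real.sin θ • e := by
    rw [he_def, smul_inv_smul₀ hsin]
    module
  have hue : ⟪u, e⟫ = 0 := by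
    rw [he_def, real_inner_smul_right, inner_sub_right, real_inner_smul_right,
      real_inner_self_eq_norm_sq, hu, hθcos]
    ring
  have he : ‖e‖ = 1 := by
    have h1 : ‖w‖ ^ 2 = 1 := by rw [hw, one_pow]
    rw [hw_eq, norm_cos_smul_add_sin_smul_sq hu hue] at h1
    have h2 : Real.sin θ ^ 2 * (‖e‖ ^ 2 - 1) = 0 := by
      linear_combination h1 - Real.sin_sq_add_cos_sq θ
    have h3 := (mul_eq_zero.1 h2).resolve_left (pow_ne_zero 2 hsin)
    nlinarith [norm_nonneg e]
  have hpar : ⟪x, u⟫ * ⟪y, e⟫ = ⟪x, e⟫ * ⟪y, u⟫ := by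
    refine mul_eq_mul_of_forall_angle fun t => ?_
    have hmem := mem_mirrors_of_irrational_angle hf hu he hue hirr hu' (hw_eq ▸ hw') t
    have hnorm : ‖Real.cos t • u + Real.sin t • e‖ = 1 := by
      rw [← sq_eq_sq₀ (norm_nonneg _) zero_le_one, norm_cos_smul_add_sin_smul_sq hu hue, he]
      linear_combination Real.sin_sq_add_cos_sq t
    have h := hxy _ hmem hnorm
    simp only [inner_add_right, real_inner_smul_right] at h
    calc _ ≤ _ := h
      _ = _ := by ring
  rw [hw_eq]
  simp only [inner_add_right, real_inner_smul_right]
  linear_combination Real.sin θ * hpar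

/-- Two level sets of a function on a sphere have a closest pair of points, and no mirror of the
function separates such a pair. -/
theorem exists_forall_mirrors_inner_mul_inner_nonneg [FiniteDimensional ℝ E] {f : E → ℂ}
    (hf : Continuous f) {x₀ y₀ : E} (hnorm : ‖x₀‖ = ‖y₀‖) :
    ∃ x y, ‖x‖ = ‖y‖ ∧ f x = f x₀ ∧ f y = f y₀ ∧
      ∀ u ∈ mirrors f, ‖u‖ = 1 → 0 ≤ ⟪x, u⟫ * ⟪y, u⟫ := by
  have hK : ∀ z : E, IsCompact {x | ‖x‖ = ‖z‖ ∧ f x = f z} := fun z => by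
    have : {x | ‖x‖ = ‖z‖ ∧ f x = f z} = Metric.sphere 0 ‖z‖ ∩ {x | f x = f z} := by
      ext x
      simp
    rw [this]
    exact (isCompact_sphere 0 _).inter_right (isClosed_eq hf continuous_const)
  obtain ⟨⟨x, y⟩, ⟨⟨hx, hx'⟩, hy, hy'⟩, hmin⟩ := ((hK x₀).prod (hK y₀)).exists_isMinOn
    ⟨(x₀, y₀), ⟨rfl, rfl⟩, rfl, rfl⟩ (f := fun p : E × E => ‖p.1 - p.2‖ ^ 2) (by fun_prop)
  simp only at hx hx' hy hy'
  refine ⟨x, y, by rw [hx, hy, hnorm], hx', hy', fun u hu hu1 => ?_⟩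
  have h : ‖x - y‖ ^ 2 ≤ ‖householder u x - y‖ ^ 2 :=
    hmin (a := (householder u x, y)) ⟨⟨by rw [norm_householder hu1, hx], by rw [hu, hx']⟩, hy, hy'⟩
  have e : ‖householder u x - y‖ ^ 2 = ‖x - y‖ ^ 2 + 4 * (⟪x, u⟫ * ⟪y, u⟫) := by
    simp only [← real_inner_self_eq_norm_sq, householder, inner_sub_left, inner_sub_right,
      real_inner_smul_left, real_inner_smul_right]
    rw [real_inner_self_eq_norm_sq u, hu1, real_inner_comm u x, real_inner_comm u y]
    ring
  linarith

/-- A continuous function invariant under an irreducible orthogonal representation of a connected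
group and under one hyperplane reflection is radial. -/
theorem eq_of_norm_eq_of_invariant [FiniteDimensional ℝ E] {Γ : Type*} [Group Γ]
    [TopologicalSpace Γ] [IsTopologicalGroup Γ] [ConnectedSpace Γ] [BaireSpace Γ]
    {ρ : Representation ℝ Γ E} (hiso : ∀ g x y, ⟪ρ g x, ρ g y⟫ = ⟪x, y⟫)
    (hcont : ∀ x, Continuous fun g => ρ g x) (hirr : ρ.IsIrreducible)
    (hdim : 1 < Module.finrank ℝ E) {f : E → ℂ} (hf : Continuous f)
    (hfρ : ∀ g x, f (ρ g x) = f x) {v : E} (hv : ‖v‖ = 1) (hvf : v ∈ mirrors f)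
    {x₀ y₀ : E} (hnorm : ‖x₀‖ = ‖y₀‖) : f x₀ = f y₀ := by
  obtain ⟨x, y, hxy, hx, hy, hsep⟩ := exists_forall_mirrors_inner_mul_inner_nonneg hf hnorm
  rw [← hx, ← hy]
  have hρnorm : ∀ g, ‖ρ g v‖ = 1 := fun g => by
    rw [norm_eq_sqrt_real_inner, hiso, ← norm_eq_sqrt_real_inner, hv]
  have hmem : ∀ g, ρ g v ∈ mirrors f := apply_mem_mirrors hiso hfρ hvf
  have hv0 : v ≠ 0 := by
    rintro rfl
    simp at hv
  have hpar : ∀ g, ⟪x, ρ g v⟫ • y - ⟪y, ρ g v⟫ • x = 0 := by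
    intro g
    by_contra hz
    have hu0 : ρ g v ≠ 0 := by
      intro h
      simpa [h] using hρnorm g
    -- By Baire, some `w` in the orbit makes an irrational angle with `ρ g v` and is not
    -- orthogonal to the nonzero vector `⟪x, ρ g v⟫ • y - ⟪y, ρ g v⟫ • x`.
    have hopen : ∀ z : E, ∀ c : ℝ, IsOpen {h | ⟪z, ρ h v⟫ ≠ c} := fun z c =>
      isOpen_ne.preimage (continuous_const.inner (hcont v))
    have hdense : Dense (⋂ q : ℚ, {h | ⟪ρ g v, ρ h v⟫ ≠ Real.cos (q * Real.pi)}) :=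
      dense_iInter_of_isOpen (fun q => hopen _ _)
        fun q => dense_setOf_inner_apply_ne hiso hirr hdim hv0 hu0 _
    obtain ⟨h, hh, hh'⟩ := hdense.inter_open_nonempty _ (hopen _ 0)
      (dense_setOf_inner_apply_ne hiso hirr hdim hv0 hz 0).nonempty
    have hkey := inner_mul_inner_eq_of_irrational_angle hf hsep (hρnorm g) (hρnorm h) (hmem g)
      (hmem h) (Set.mem_iInter.1 hh')
    apply hh
    rw [inner_sub_left, real_inner_smul_left, real_inner_smul_left, hkey]
    ring
  by_cases hx0 : x = 0
  · rw [hx0, norm_zero, eq_comm, norm_eq_zero] at hxy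
    rw [hx0, hxy]
  obtain ⟨g, hg⟩ := (dense_setOf_inner_apply_ne hiso hirr hdim hv0 hx0 0).nonempty
  have hg : ⟪x, ρ g v⟫ ≠ 0 := hg
  obtain ⟨c, hc⟩ : ∃ c, c = ⟪y, ρ g v⟫ / ⟪x, ρ g v⟫ := ⟨_, rfl⟩
  have hyc : y = c • x := by
    have h := sub_eq_zero.1 (hpar g)
    rw [hc, div_eq_inv_mul, mul_smul, ← h, inv_smul_smul₀ hg]
  have hc0 : 0 ≤ c := by
    have h := hsep _ (hmem g) (hρnorm g)
    have h2 : c = (⟪x, ρ g v⟫ * ⟪y, ρ g v⟫) / ⟪x, ρ g v⟫ ^ 2 := by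
      rw [hc]
      field_simp
    rw [h2]
    positivity
  have hc1 : c = 1 := by
    rw [hyc, norm_smul, Real.norm_of_nonneg hc0] at hxy
    exact mul_right_cancel₀ (norm_ne_zero_iff.2 hx0) (by rw [← hxy, one_mul])
  rw [hyc, hc1, one_smul]

end Reflections

/-! ### Measures with radial characteristic function -/

section RadialMeasures

variable {E : Type*} [NormedAddCommGroup E] [InnerProductSpace ℝ E] [MeasurableSpace E]
  [BorelSpace E]

theorem charFun_map_of_adjoint (μ : Measure E) {L L' : E → E} (hL : Measurable L)
    (hadj : ∀ x t, ⟪L x, t⟫ = ⟪x, L' t⟫) [SecondCountableTopology E] (t : E) :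
    charFun (μ.map L) t = charFun μ (L' t) := by
  rw [charFun_apply, charFun_apply, integral_map hL.aemeasurable (by fun_prop)]
  simp only [hadj]

/-- A measure is radial if its characteristic function depends only on the norm of its argument;
for finite measures this says that all linear isometries preserve the measure. -/
def IsRadial (μ : Measure E) : Prop := ∀ x y : E, ‖x‖ = ‖y‖ → charFun μ x = charFun μ y

variable [FiniteDimensional ℝ E]

theorem IsRadial.map_eq {μ : Measure E} [IsFiniteMeasure μ] (hμ : IsRadial μ)
    {L L' : E → E} (hL : Measurable L) (hadj : ∀ x t, ⟪L x, t⟫ = ⟪x, L' t⟫)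
    (hnorm : ∀ t, ‖L' t‖ = ‖t‖) : μ.map L = μ := by
  have := FiniteDimensional.complete ℝ E
  have := FiniteDimensional.proper_real E
  refine Measure.ext_of_charFun (funext fun t => ?_)
  rw [charFun_map_of_adjoint μ hL hadj, hμ _ _ (hnorm t)]

theorem IsRadial.map_linearIsometryEquiv {μ : Measure E} [IsFiniteMeasure μ] (hμ : IsRadial μ)
    (L : E ≃ₗᵢ[ℝ] E) : μ.map L = μ :=
  hμ.map_eq L.continuous.measurable (L' := L.symm)
    (fun x t => by rw [← L.inner_map_map x, L.apply_symm_apply]) L.symm.norm_map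

theorem isRadial_of_forall_map_eq {μ : Measure E} (h : ∀ L : E ≃ₗᵢ[ℝ] E, μ.map L = μ) :
    IsRadial μ := by
  intro x y hxy
  have := FiniteDimensional.proper_real E
  have hx := charFun_map_of_adjoint μ (L := (ℝ ∙ (x - y))ᗮ.reflection)
    (L' := (ℝ ∙ (x - y))ᗮ.reflection) (LinearIsometryEquiv.continuous _).measurable
    (fun a b => by
      rw [← ((ℝ ∙ (x - y))ᗮ.reflection).inner_map_map a, Submodule.reflection_reflection]) x
  rwa [h, Submodule.reflection_sub hxy] at hx

/-- Integrating `exp (i ‖t‖ ⟪x, y⟫)` against two radial measures on the unit sphere in either order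
shows that their characteristic functions are proportional. -/
theorem charFun_mul_eq_of_isRadial {μ ν : Measure E} [IsFiniteMeasure μ] [IsFiniteMeasure ν]
    (hμ : IsRadial μ) (hν : IsRadial ν) (hμ1 : ∀ᵐ x ∂μ, ‖x‖ = 1) (hν1 : ∀ᵐ x ∂ν, ‖x‖ = 1)
    (t : E) : ν.real Set.univ * charFun μ t = μ.real Set.univ * charFun ν t := by
  have := FiniteDimensional.proper_real E
  have key : ∀ {κ κ' : Measure E} [IsFiniteMeasure κ'], IsRadial κ → (∀ᵐ x ∂κ', ‖x‖ = 1) →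
      ∫ y, charFun κ (‖t‖ • y) ∂κ' = κ'.real Set.univ * charFun κ t := by
    intro κ κ' _ hκ hκ'
    have : ∫ y, charFun κ (‖t‖ • y) ∂κ' = ∫ _, charFun κ t ∂κ' := by
      refine integral_congr_ae ?_
      filter_upwards [hκ'] with y hy
      exact hκ _ _ (by rw [norm_smul, norm_norm, hy, mul_one])
    rw [this, integral_const]
    exact Complex.real_smul
  rw [← key hμ hν1, ← key hν hμ1]
  simp only [charFun_apply]
  rw [integral_integral_swap]
  · refine integral_congr_ae (.of_forall fun x => integral_congr_ae (.of_forall fun y => ?_))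
    simp only [real_inner_smul_right, real_inner_comm x y]
  · refine Integrable.of_bound (C := 1) (Continuous.aestronglyMeasurable ?_)
      (.of_forall fun p => ?_)
    · simp only [Function.uncurry_def]
      fun_prop
    · simp only [Function.uncurry_def, Complex.norm_exp_ofReal_mul_I, le_refl]

/-- Up to a scalar there is only one radial finite measure on the unit sphere. -/
theorem measure_smul_eq_of_isRadial {μ ν : Measure E} [IsFiniteMeasure μ] [IsProbabilityMeasure ν]
    (hμ : IsRadial μ) (hν : IsRadial ν) (hμ1 : ∀ᵐ x ∂μ, ‖x‖ = 1) (hν1 : ∀ᵐ x ∂ν, ‖x‖ = 1) :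
    μ = μ Set.univ • ν := by
  have := FiniteDimensional.complete ℝ E
  have := FiniteDimensional.proper_real E
  have := ν.smul_finite (measure_ne_top μ Set.univ)
  refine Measure.ext_of_charFun (funext fun t => ?_)
  have h := charFun_mul_eq_of_isRadial hμ hν hμ1 hν1 t
  rw [probReal_univ, Complex.ofReal_one, one_mul] at h
  rw [h, charFun_apply, charFun_apply, integral_smul_measure]
  exact Complex.real_smul.symm

/-- The norm and the direction of a random vector with radial law are independent. -/
theorem indepFun_norm_direction_of_isRadial {Ω : Type*} [MeasurableSpace Ω] {P : Measure Ω}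
    [IsProbabilityMeasure P] {X : Ω → E} (hX : Measurable X) (hrad : IsRadial (P.map X))
    (h0 : ∀ᵐ ω ∂P, X ω ≠ 0) :
    IndepFun (fun ω => ‖X ω‖) (fun ω => ‖X ω‖⁻¹ • X ω) P := by
  have := FiniteDimensional.proper_real E
  have : IsProbabilityMeasure (P.map X) := Measure.isProbabilityMeasure_map hX.aemeasurable
  let dir : E → E := fun x => ‖x‖⁻¹ • x
  have hdir : Measurable dir := by fun_prop
  have hne : ∀ᵐ x ∂P.map X, x ≠ 0 :=
    (ae_map_iff hX.aemeasurable (measurableSet_singleton 0).compl).2 h0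
  -- The law of the direction on the event that the norm lies in `A`.
  let κ : Set ℝ → Measure E := fun A => ((P.map X).restrict (norm ⁻¹' A)).map dir
  have hκ1 : ∀ A, ∀ᵐ x ∂κ A, ‖x‖ = 1 := fun A => by
    refine (ae_map_iff hdir.aemeasurable (measurableSet_eq_fun measurable_norm
      measurable_const)).2 (ae_restrict_of_ae ?_)
    filter_upwards [hne] with x hx using norm_smul_inv_norm hx
  have hκrad : ∀ A, MeasurableSet A → IsRadial (κ A) := fun A hA => by
    refine isRadial_of_forall_map_eq fun L => ?_
    have hL : Measurable L := L.continuous.measurable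
    have hcomm : L ∘ dir = dir ∘ L := by
      ext x
      simp [dir]
    have hpre : L ⁻¹' (norm ⁻¹' A) = norm ⁻¹' A := by
      ext x
      simp
    have hrestr : ((P.map X).restrict (norm ⁻¹' A)).map L = (P.map X).restrict (norm ⁻¹' A) := by
      conv_lhs => rw [← hpre]
      rw [← Measure.restrict_map hL (measurable_norm hA), hrad.map_linearIsometryEquiv L]
    simp only [κ]
    rw [Measure.map_map hL hdir, hcomm, ← Measure.map_map hdir hL, hrestr]
  have hκ_apply : ∀ A B, MeasurableSet A → MeasurableSet B →
      κ A B = P ((fun ω => ‖X ω‖) ⁻¹' A ∩ (fun ω => ‖X ω‖⁻¹ • X ω) ⁻¹' B) := by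
    intro A B hA hB
    simp only [κ]
    rw [Measure.map_apply hdir hB, Measure.restrict_apply (hdir hB),
      Measure.map_apply hX ((hdir hB).inter (measurable_norm hA)), Set.inter_comm]
    rfl
  have hprob : IsProbabilityMeasure (κ Set.univ) :=
    ⟨by rw [hκ_apply _ _ .univ .univ]; simp⟩
  rw [indepFun_iff_measure_inter_preimage_eq_mul]
  intro A B hA hB
  have h := congrArg (fun m : Measure E => m B) (measure_smul_eq_of_isRadial (hκrad A hA)
    (hκrad _ .univ) (hκ1 A) (hκ1 _))
  simp only [Measure.smul_apply, smul_eq_mul, hκ_apply _ _ hA hB, hκ_apply _ _ hA .univ,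
    hκ_apply _ _ .univ hB, Set.preimage_univ, Set.inter_univ, Set.univ_inter] at h
  exact h

end RadialMeasures

/-! ### Exchangeable random vectors with irreducible symmetry -/

section Exchangeable

variable {Ω : Type*} [MeasurableSpace Ω] {P : Measure Ω} {d : ℕ}

theorem isIrreducible_rotationRep_comp {G : Type*} [Group G] {φ : G →* SO d}
    (h : ActsIrreducibly φ.range) :
    Representation.IsIrreducible ((rotationRep d).comp φ) := by
  have h' : IsSimpleOrder (Subrepresentation ((rotationRep d).comp φ.range.subtype)) := h
  have hnt : Nontrivial (Subrepresentation ((rotationRep d).comp φ)) := by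
    obtain ⟨a, b, hab⟩ := h'.toNontrivial
    refine ⟨⟨a.toSubmodule, fun g x hx => a.apply_mem_toSubmodule ⟨φ g, g, rfl⟩ hx⟩,
      ⟨b.toSubmodule, fun g x hx => b.apply_mem_toSubmodule ⟨φ g, g, rfl⟩ hx⟩, fun hne => hab ?_⟩
    have := congrArg Subrepresentation.toSubmodule hne
    exact Subrepresentation.toSubmodule_injective this
  refine { exists_pair_ne := hnt.exists_pair_ne, eq_bot_or_eq_top := fun M => ?_ }
  have hM := h.submodule_eq_bot_or_eq_top M.toSubmodule (by
    rintro ⟨_, g, rfl⟩ x hx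
    exact M.apply_mem_toSubmodule g hx)
  exact hM.imp (fun e => Subrepresentation.toSubmodule_injective e)
    (fun e => Subrepresentation.toSubmodule_injective e)

theorem inner_rotationRep_left (g : SO d) (x y : EuclideanSpace ℝ (Fin d)) :
    ⟪rotationRep d g x, y⟫ = ⟪x, rotationRep d g⁻¹ y⟫ :=
  (rotationRep d).inner_apply_left_eq inner_rotationRep g x y

theorem measurable_rotationRep (g : SO d) : Measurable (rotationRep d g) :=
  (LinearMap.continuous_of_finiteDimensional _).measurable

theorem charFun_rotationRep_of_lawInvariantUnder {X : Ω → EuclideanSpace ℝ (Fin d)}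
    (hX : Measurable X) {H : Subgroup (SO d)} (hinv : LawInvariantUnder P X H) {g : SO d}
    (hg : g ∈ H) (t : EuclideanSpace ℝ (Fin d)) :
    charFun (P.map X) (rotationRep d g t) = charFun (P.map X) t := by
  have h := (hinv g⁻¹ (inv_mem hg)).map_eq
  have h' : (P.map X).map (rotationRep d g⁻¹) = P.map X := by
    rw [Measure.map_map (measurable_rotationRep _) hX]
    exact h
  conv_rhs => rw [← h', charFun_map_of_adjoint _ (measurable_rotationRep _)
    (inner_rotationRep_left _), inv_inv]

/-- The reflection in the hyperplane orthogonal to `e i - e j` exchanges two coordinates. -/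
theorem householder_single_sub_single {i j : Fin d} (hij : i ≠ j)
    (x : EuclideanSpace ℝ (Fin d)) :
    householder ((√2)⁻¹ • (EuclideanSpace.single i (1 : ℝ) - EuclideanSpace.single j 1)) x =
      WithLp.toLp 2 fun k => x (Equiv.swap i j k) := by
  have h2 : (√2)⁻¹ * (√2)⁻¹ = (2 : ℝ)⁻¹ := by
    rw [← mul_inv, Real.mul_self_sqrt zero_le_two]
  have hform : householder ((√2)⁻¹ • (EuclideanSpace.single i (1 : ℝ) -
      EuclideanSpace.single j 1)) x =
      x - (x i - x j) • (EuclideanSpace.single i (1 : ℝ) - EuclideanSpace.single j 1) := by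
    rw [householder, real_inner_smul_left, smul_smul, inner_sub_left,
      EuclideanSpace.inner_single_left, EuclideanSpace.inner_single_left]
    congr 2
    simp only [map_one, one_mul]
    linear_combination 2 * (x i - x j) * h2
  rw [hform]
  ext k
  by_cases hki : k = i
  · subst hki
    simp [hij]
  by_cases hkj : k = j
  · subst hkj
    simp [hij.symm]
  · simp [Equiv.swap_apply_of_ne_of_ne hki hkj, hki, hkj]

theorem norm_single_sub_single {i j : Fin d} (hij : i ≠ j) :
    ‖(√2)⁻¹ • (EuclideanSpace.single i (1 : ℝ) - EuclideanSpace.single j (1 : ℝ))‖ = 1 := by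
  have h : ‖EuclideanSpace.single i (1 : ℝ) - EuclideanSpace.single j (1 : ℝ)‖ = √2 := by
    rw [norm_eq_sqrt_real_inner, inner_sub_left, EuclideanSpace.inner_single_left,
      EuclideanSpace.inner_single_left]
    simp [hij, hij.symm]
    norm_num
  rw [norm_smul, h, norm_inv, Real.norm_of_nonneg (Real.sqrt_nonneg 2),
    inv_mul_cancel₀ (by positivity)]

theorem mem_mirrors_of_exchangeableFamily {X : Ω → EuclideanSpace ℝ (Fin d)}
    (hX : Measurable X) (hexch : ExchangeableFamily P fun i ω => X ω i) {i j : Fin d}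
    (hij : i ≠ j) :
    (√2)⁻¹ • (EuclideanSpace.single i (1 : ℝ) - EuclideanSpace.single j 1) ∈
      mirrors (charFun (P.map X)) := by
  obtain ⟨u, hu⟩ : ∃ u, u = (√2)⁻¹ • (EuclideanSpace.single i (1 : ℝ) -
    EuclideanSpace.single j (1 : ℝ)) := ⟨_, rfl⟩
  have hswap := householder_single_sub_single (d := d) hij
  have hnorm := norm_single_sub_single (d := d) hij
  rw [← hu] at hswap hnorm ⊢
  have hmeas : Measurable (householder u) := by
    unfold householder
    fun_prop
  have hmap : (P.map X).map (householder u) = P.map X := by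
    rw [Measure.map_map hmeas hX]
    have h := ((hexch (Equiv.swap i j)).comp (WithLp.measurable_toLp 2 (Fin d → ℝ))).map_eq
    have e : householder u ∘ X = WithLp.toLp 2 ∘ fun ω k => X ω (Equiv.swap i j k) :=
      funext fun ω => hswap (X ω)
    rw [e, h]
    rfl
  intro t
  conv_rhs => rw [← hmap]
  refine (charFun_map_of_adjoint _ hmeas (fun x t => ?_) t).symm
  rw [← inner_householder_householder hnorm x, householder_householder hnorm]

end Exchangeable

theorem proposition3p4 {Ω : Type*} [MeasurableSpace Ω] (P : Measure Ω) [IsProbabilityMeasure P]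
    (k d : ℕ) (hk : 3 ≤ k) (hd : 3 ≤ d)
    (φ : SO k →* SO d) (hφ : Continuous φ) (hirr : ActsIrreducibly φ.range)
    (X : Ω → EuclideanSpace ℝ (Fin d)) (hX : Measurable X)
    (hinv : LawInvariantUnder P X φ.range)
    (hexch : ExchangeableFamily P (fun i ω => X ω i)) :
    LawInvariantUnder P X ⊤ ∧
      ((∀ᵐ ω ∂P, X ω ≠ 0) →
        IndepFun (fun ω => ‖X ω‖) (fun ω => ‖X ω‖⁻¹ • X ω) P) := by
  have : IsProbabilityMeasure (P.map X) := Measure.isProbabilityMeasure_map hX.aemeasurable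
  have : ConnectedSpace (SO k) := SO.connectedSpace (by omega)
  have hij : (⟨0, by omega⟩ : Fin d) ≠ ⟨1, by omega⟩ := by simp
  have hrad : IsRadial (P.map X) := fun x y hxy =>
    eq_of_norm_eq_of_invariant (ρ := (rotationRep d).comp φ)
      (fun g => inner_rotationRep (φ g)) (fun x => (continuous_rotationRep_apply x).comp hφ)
      (isIrreducible_rotationRep_comp hirr) (by rw [finrank_euclideanSpace_fin]; omega)
      continuous_charFun
      (fun g => charFun_rotationRep_of_lawInvariantUnder hX hinv ⟨g, rfl⟩)
      (norm_single_sub_single hij) (mem_mirrors_of_exchangeableFamily hX hexch hij) hxy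
  refine ⟨fun g _ => ⟨((measurable_rotationRep g).comp hX).aemeasurable, hX.aemeasurable, ?_⟩,
    indepFun_norm_direction_of_isRadial hX hrad⟩
  have hmap := hrad.map_eq (measurable_rotationRep g) (inner_rotationRep_left g)
    (fun t => by rw [norm_eq_sqrt_real_inner, inner_rotationRep, ← norm_eq_sqrt_real_inner])
  rwa [Measure.map_map (measurable_rotationRep g) hX] at hmap
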